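/- Let $d\ge 1$ be an integer and let $\mathcal C$ be an additive category. All sequences below are complexes $B_\bullet\colon B_{d+1}\xrightarrow{\partial_{d+1}}B_d\to\cdots\to B_1\xrightarrow{\partial_1}B_0$ in $\mathcal C$. Such a sequence is *left $d$-exact* if $0\to\mathcal C(T,B_{d+1})\to\mathcal C(T,B_d)\to\cdots\to\mathcal C(T,B_0)$ is exact for all $T\in\mathcal C$, *right $d$-exact* if $0\to\mathcal C(B_0,T)\to\mathcal C(B_1,T)\to\cdots\to\mathcal C(B_{d+1},T)$ is exact for all $T\in\mathcal C$, and *$d$-exact* if it is both. A morphism $\varphi$ of $d$-exact sequences is a *weak isomorphism* if $\varphi_k$ and $\varphi_{k+1}$ are isomorphisms for some $k\in\{0,\dots,d+1\}$, where $d+2$ is read as $0$. A *$d$-exact category* is a pair $(\mathcal C,\mathcal E)$, where $\mathcal C$ is an additive category and $\mathcal E$ is a class of $d$-exact sequences (called *$\mathcal E$-admissible*; the morphisms $\partial_{d+1}$, respectively $\partial_1$, of members of $\mathcal E$ are the *admissible inflations*, respectively *admissible deflations*), such that: * $\mathcal E$ is closed under weak isomorphisms (if there is a weak isomorphism $B_\bullet\to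 B'_\bullet$ of $d$-exact sequences, then $B_\bullet\in\mathcal E$ if and only if $B'_\bullet\in\mathcal E$); * the zero complex is in $\mathcal E$; * the admissible inflations are closed under composition, and so are the admissible deflations; * for each $B_\bullet\in\mathcal E$ and each morphism $h\colon B_{d+1}\to D_{d+1}$ there are $D_\bullet\in\mathcal E$ and a morphism of complexes $\varphi\colon B_\bullet\to D_\bullet$ with $\varphi_{d+1}=h$ and $\varphi_0=\mathrm{id}$, whose part in degrees $d+1,\dots,1$ is a $d$-pushout diagram, that is, its mapping cone $B_{d+1}\to B_d\oplus D_{d+1}\to\cdots\to B_1\oplus D_2\to D_1$ is right $d$-exact; * for each $B_\bullet\in\mathcal E$ and each morphism $g\colon D_0\to B_0$ there are $D_\bullet\in\mathcal E$ and a morphism of complexes $\varphi\colon D_\bullet\to B_\bullet$ with $\varphi_0=g$ and $\varphi_{d+1}=\mathrm{id}$, whose part in degrees $d,\dots,0$ is a $d$-pullback diagram, that is, its mapping cone $D_d\to D_{d-1}\oplus B_d\to\cdots\to D_0\oplus B_1\to B_0$ is left $d$-exact. It is *skeletally small* if $\mathcal C$ is, that is, if $\mathcal C$ is equivalent to a small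 category. **Proposition.** Let $(\mathcal C,\mathcal E)$ be a skeletally small $d$-exact category and let $\mathcal X\subseteq\mathcal C$ be a full subcategory. Let $\mathcal E_{\mathcal X}\subseteq\mathcal E$ be the class of all $\mathcal E$-admissible $d$-exact sequences $B_\bullet$ such that $\mathcal C(X,\partial_1)\colon\mathcal C(X,B_1)\to\mathcal C(X,B_0)$ is surjective for every $X\in\mathcal X$. Then $(\mathcal C,\mathcal E_{\mathcal X})$ is a skeletally small $d$-exact category. -/

import Mathlib

open CategoryTheory CategoryTheory.Limits

universe w v u

namespace DExact

variable {C : Type u} [Category.{v} C] [Preadditive C]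

/-- A sequence `B_{d+1} ⟶ B_d ⟶ ⋯ ⟶ B_1 ⟶ B_0` whose consecutive composites vanish is
encoded as a chain complex `B` concentrated in degrees `0, …, d+1`; the morphism `∂_i` is
`B.d i (i-1)`. -/
def IsConcentrated (d : ℕ) (B : ChainComplex C ℕ) : Prop :=
  ∀ i, d + 1 < i → IsZero (B.X i)

/-- `B_{d+1} ⟶ ⋯ ⟶ B_1 ⟶ B_0` is left `d`-exact: for every object `T`, the sequence of abelian
groups `0 ⟶ C(T, B_{d+1}) ⟶ C(T, B_d) ⟶ ⋯ ⟶ C(T, B_1) ⟶ C(T, B_0)` is exact, i.e. it is exact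
at `C(T, B_{i+1})` for all `0 ≤ i ≤ d` (for `i = d` one has `B_{d+2} = 0`, so exactness there
says that `∂_{d+1}` is a monomorphism). -/
structure IsLeftDExact (d : ℕ) (B : ChainComplex C ℕ) : Prop where
  concentrated : IsConcentrated d B
  exact : ∀ i ≤ d, ∀ (T : C) (x : T ⟶ B.X (i + 1)), x ≫ B.d (i + 1) i = 0 →
    ∃ y : T ⟶ B.X (i + 2), y ≫ B.d (i + 2) (i + 1) = x

/-- `B_{d+1} ⟶ ⋯ ⟶ B_1 ⟶ B_0` is right `d`-exact: for every object `T`, the sequence of abelian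
groups `0 ⟶ C(B_0, T) ⟶ C(B_1, T) ⟶ ⋯ ⟶ C(B_d, T) ⟶ C(B_{d+1}, T)` is exact. -/
structure IsRightDExact (d : ℕ) (B : ChainComplex C ℕ) : Prop where
  concentrated : IsConcentrated d B
  exact_zero : ∀ (T : C) (x : B.X 0 ⟶ T), B.d 1 0 ≫ x = 0 → x = 0
  exact : ∀ i < d, ∀ (T : C) (x : B.X (i + 1) ⟶ T), B.d (i + 2) (i + 1) ≫ x = 0 →
    ∃ y : B.X i ⟶ T, B.d (i + 1) i ≫ y = x

/-- A `d`-exact sequence: left and right `d`-exact. -/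
structure IsDExactSequence (d : ℕ) (B : ChainComplex C ℕ) : Prop where
  left : IsLeftDExact d B
  right : IsRightDExact d B

/-- A morphism `φ` of `d`-exact sequences is a weak isomorphism if `φ_k` and `φ_{k+1}` are
isomorphisms for some `k ∈ {0, …, d+1}`, where `d+2` is read as `0`. -/
def IsWeakIso (d : ℕ) {B B' : ChainComplex C ℕ} (φ : B ⟶ B') : Prop :=
  (∃ k ≤ d, IsIso (φ.f k) ∧ IsIso (φ.f (k + 1))) ∨ (IsIso (φ.f (d + 1)) ∧ IsIso (φ.f 0))

/-- `f` is the first morphism `∂_{d+1}` of a member of `E` (up to isomorphism of arrows; this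
is no restriction when `E` is closed under isomorphisms). -/
def IsInflation (d : ℕ) (E : ObjectProperty (ChainComplex C ℕ)) : MorphismProperty C :=
  fun _ _ f ↦ ∃ B : ChainComplex C ℕ, E B ∧ Nonempty (Arrow.mk (B.d (d + 1) d) ≅ Arrow.mk f)

/-- `f` is the last morphism `∂_1` of a member of `E` (up to isomorphism of arrows). -/
def IsDeflation (E : ObjectProperty (ChainComplex C ℕ)) : MorphismProperty C :=
  fun _ _ f ↦ ∃ B : ChainComplex C ℕ, E B ∧ Nonempty (Arrow.mk (B.d 1 0) ≅ Arrow.mk f)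

/-- The part of `φ : D ⟶ B` in degrees `d, …, 0`, i.e.
```
D_d ⟶ D_{d-1} ⟶ ⋯ ⟶ D_0
 |        |            |
B_d ⟶ B_{d-1} ⟶ ⋯ ⟶ B_0
```
is a `d`-pullback diagram: its mapping cone
`D_d ⟶ D_{d-1} ⊕ B_d ⟶ ⋯ ⟶ D_0 ⊕ B_1 ⟶ B_0` is left `d`-exact. Written out on morphisms from a
test object `T` (a morphism to a biproduct being a pair, and the signs of the cone being absorbed
in the components), `exact` is the exactness at `D_i ⊕ B_{i+1}` for `0 ≤ i < d`, and `mono` is the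
exactness at `D_d`. For `i = 0`, the condition on `D.d 0 (0 - 1) = 0` is void; for `i + 1 = d`, the
cone has no summand `B_{i+2}`, so that `y'` has to vanish. -/
structure IsDPullback (d : ℕ) {D B : ChainComplex C ℕ} (φ : D ⟶ B) : Prop where
  exact : ∀ i < d, ∀ (T : C) (x : T ⟶ D.X i) (y : T ⟶ B.X (i + 1)),
    x ≫ D.d i (i - 1) = 0 → x ≫ φ.f i = y ≫ B.d (i + 1) i →
    ∃ (x' : T ⟶ D.X (i + 1)) (y' : T ⟶ B.X (i + 2)), (i + 1 = d → y' = 0) ∧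
      x' ≫ D.d (i + 1) i = x ∧ x' ≫ φ.f (i + 1) + y' ≫ B.d (i + 2) (i + 1) = y
  mono : ∀ (T : C) (x : T ⟶ D.X d), x ≫ D.d d (d - 1) = 0 → x ≫ φ.f d = 0 → x = 0

/-- The part of `φ : B ⟶ D` in degrees `d+1, …, 1`, i.e.
```
B_{d+1} ⟶ B_d ⟶ ⋯ ⟶ B_1
   |        |          |
D_{d+1} ⟶ D_d ⟶ ⋯ ⟶ D_1
```
is a `d`-pushout diagram: its mapping cone
`B_{d+1} ⟶ B_d ⊕ D_{d+1} ⟶ ⋯ ⟶ B_1 ⊕ D_2 ⟶ D_1` is right `d`-exact. Written out on morphisms to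
a test object `T`, `exact` is the exactness at `B_{i+1} ⊕ D_{i+2}` for `0 ≤ i < d`, and `epi` is
the exactness at `D_1`. For `i + 1 = d`, the condition on `D.d (d + 2) (d + 1) = 0` is void (as
`D` is concentrated in degrees `0, …, d+1`); for `i = 0`, the cone has no summand `B_0`, so that
`x'` has to vanish. -/
structure IsDPushout (d : ℕ) {B D : ChainComplex C ℕ} (φ : B ⟶ D) : Prop where
  exact : ∀ i < d, ∀ (T : C) (x : B.X (i + 1) ⟶ T) (y : D.X (i + 2) ⟶ T),
    D.d (i + 3) (i + 2) ≫ y = 0 → φ.f (i + 2) ≫ y = B.d (i + 2) (i + 1) ≫ x →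
    ∃ (x' : B.X i ⟶ T) (y' : D.X (i + 1) ⟶ T), (i = 0 → x' = 0) ∧
      D.d (i + 2) (i + 1) ≫ y' = y ∧ φ.f (i + 1) ≫ y' + B.d (i + 1) i ≫ x' = x
  epi : ∀ (T : C) (y : D.X 1 ⟶ T), D.d 2 1 ≫ y = 0 → φ.f 1 ≫ y = 0 → y = 0

/-- `E` is a `d`-exact structure on `C`. In the pushout and pullback axioms the prescribed end
term, and the end term that is left unchanged, are identified through isomorphisms; this makes no
difference as `E` is closed under isomorphisms. -/
structure IsDExactStructure (d : ℕ) (E : ObjectProperty (ChainComplex C ℕ)) : Prop where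
  isDExactSequence : ∀ B, E B → IsDExactSequence d B
  weakIso : ∀ (B B' : ChainComplex C ℕ) (φ : B ⟶ B'), IsDExactSequence d B →
    IsDExactSequence d B' → IsWeakIso d φ → (E B ↔ E B')
  zero : ∀ B : ChainComplex C ℕ, (∀ i, IsZero (B.X i)) → E B
  inflation_comp : ∀ (X Y Z : C) (f : X ⟶ Y) (g : Y ⟶ Z),
    IsInflation d E f → IsInflation d E g → IsInflation d E (f ≫ g)
  deflation_comp : ∀ (X Y Z : C) (f : X ⟶ Y) (g : Y ⟶ Z),
    IsDeflation E f → IsDeflation E g → IsDeflation E (f ≫ g)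
  pushout : ∀ B : ChainComplex C ℕ, E B → ∀ (A : C) (h : B.X (d + 1) ⟶ A),
    ∃ (D : ChainComplex C ℕ) (φ : B ⟶ D) (e : A ≅ D.X (d + 1)), E D ∧
      φ.f (d + 1) = h ≫ e.hom ∧ IsIso (φ.f 0) ∧ IsDPushout d φ
  pullback : ∀ B : ChainComplex C ℕ, E B → ∀ (A : C) (g : A ⟶ B.X 0),
    ∃ (D : ChainComplex C ℕ) (φ : D ⟶ B) (e : D.X 0 ≅ A), E D ∧
      φ.f 0 = e.hom ≫ g ∧ IsIso (φ.f (d + 1)) ∧ IsDPullback d φ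

/-- `(C, E)` is a skeletally small `d`-exact category (`C` being additive): the category `C` is
equivalent to a `w`-small one, and `E` is a `d`-exact structure on it. -/
structure IsSkeletallySmallDExactCategory (d : ℕ) (E : ObjectProperty (ChainComplex C ℕ)) :
    Prop where
  essentiallySmall : EssentiallySmall.{w} C
  isDExactStructure : IsDExactStructure d E

/-- The members `B` of `E` for which `C(X, ∂_1) : C(X, B_1) ⟶ C(X, B_0)` is surjective for every
object `X` of the full subcategory `𝒳`. -/
def relative (E : ObjectProperty (ChainComplex C ℕ)) (𝒳 : ObjectProperty C) :
    ObjectProperty (ChainComplex C ℕ) :=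
  fun B ↦ E B ∧ ∀ X : C, 𝒳 X → Function.Surjective (fun h : X ⟶ B.X 1 ↦ h ≫ B.d 1 0)

end DExact

/-!
Only the closure of `relative E 𝒳` under weak isomorphisms and the composition of its inflations
require an argument: the deflation, pushout and pullback axioms concern the surjectivity of
`C(X, ∂₁)` alone, and a lift is written down directly.

The difficulty is that these two axioms give information in some degree `k` of a sequence, while
membership in `relative E 𝒳` is a condition in degree `0`. The bridge is as follows. Let `D` be
right `d`-exact and let `B` be left `d`-exact. For a morphism `δ : D ⟶ B`, being of the form
`∂ h + h' ∂` in degree `i` (`NullAt`) is a condition that does not depend on `i`: it moves up by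
left exactness of `B` (`NullAt.succ`) and down by right exactness of `D` (`NullAt.pred`). In degree
`0` it says that `δ₀` factors through `∂₁`, and in degree `d + 1` that `δ_{d+1}` factors through
`∂_{d+1}`. To lift `x : X ⟶ B₀` along `∂₁`, pull `B` back along `x` to some `D ∈ E` with `D₀ ≅ X`;
it then suffices to check that `D ⟶ B` is null in one degree of choice (`exists_lift_of_nullAt`).

Conversely, if `B` is in `relative E 𝒳` and `D₀` is in `𝒳` up to isomorphism, then every
commutative square between `∂_{i+1}` of `D` and `∂_{i+1}` of `B` is null in degree `i`, even if it
is not given as part of a morphism of complexes (`nullAt_of_forall_factors`). Hence nullity can be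
transported along isomorphisms of a single differential, which gives the invariance under weak
isomorphisms. For a composite of inflations `f ≫ g`, with `f`, `g` and `f ≫ g` being `∂_{d+1}` of
`B`, `B'` and `B''` up to isomorphism (so that `B''_{d+1} ≅ B_{d+1}`, `B'_{d+1} ≅ B_d` and
`B''_d ≅ B'_d`), nullity of `D ⟶ B'' ⟶ B'` makes `D_{d+1} ⟶ B_{d+1} ⟶ B_d` factor
through `D_d`, and nullity of the resulting square from `D` to `B` makes `D_{d+1} ⟶ B''_{d+1}`
factor through `D_d`.
-/

namespace DExact

variable {C : Type u} [Category.{v} C] [Preadditive C] {d : ℕ}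

/-! ### Nullity of a morphism in a single degree -/

/-- A morphism `a : D_i ⟶ B_i` is null if it is of the form `∂ h + h' ∂`, as the component in
degree `i` of a null-homotopic morphism. For `i = 0`, the differential `D.d 0 (0 - 1)` is zero, so
that the first summand vanishes. -/
def NullAt (D B : ChainComplex C ℕ) (i : ℕ) (a : D.X i ⟶ B.X i) : Prop :=
  ∃ (h : D.X (i - 1) ⟶ B.X i) (h' : D.X i ⟶ B.X (i + 1)),
    a = D.d i (i - 1) ≫ h + h' ≫ B.d (i + 1) i

lemma nullAt_zero_iff {D B : ChainComplex C ℕ} (a : D.X 0 ⟶ B.X 0) :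
    NullAt D B 0 a ↔ ∃ h : D.X 0 ⟶ B.X 1, h ≫ B.d 1 0 = a := by
  have h0 : D.d 0 (0 - 1) = 0 := D.shape _ _ (by simp)
  constructor
  · rintro ⟨h, h', rfl⟩
    exact ⟨h', by rw [h0, zero_comp, zero_add]⟩
  · rintro ⟨h', rfl⟩
    exact ⟨0, h', by rw [comp_zero, zero_add]⟩

lemma nullAt_top_iff {D B : ChainComplex C ℕ} (hB : IsConcentrated d B)
    (a : D.X (d + 1) ⟶ B.X (d + 1)) :
    NullAt D B (d + 1) a ↔ ∃ h : D.X d ⟶ B.X (d + 1), D.d (d + 1) d ≫ h = a := by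
  have h0 : B.d (d + 1 + 1) (d + 1) = 0 := (hB (d + 1 + 1) (by omega)).eq_of_src _ _
  constructor
  · rintro ⟨h, h', rfl⟩
    exact ⟨h, by rw [h0, comp_zero, add_zero]; rfl⟩
  · rintro ⟨h, rfl⟩
    exact ⟨h, 0, by rw [zero_comp, add_zero]; rfl⟩

/-- Left exactness of the target moves nullity up by one degree. -/
lemma NullAt.succ {D B : ChainComplex C ℕ} (hB : IsLeftDExact d B) {i : ℕ} (hi : i ≤ d)
    {a : D.X i ⟶ B.X i} {a' : D.X (i + 1) ⟶ B.X (i + 1)}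
    (sq : a' ≫ B.d (i + 1) i = D.d (i + 1) i ≫ a) (ha : NullAt D B i a) :
    NullAt D B (i + 1) a' := by
  obtain ⟨h, h', rfl⟩ := ha
  obtain ⟨y, hy⟩ := hB.exact i hi _ (a' - D.d (i + 1) i ≫ h') (by
    simp [Preadditive.sub_comp, sq, Preadditive.comp_add])
  exact ⟨h', y, by simp [hy]⟩

/-- Right exactness of the source moves nullity down by one degree. -/
lemma NullAt.pred {D B : ChainComplex C ℕ} (hD : IsRightDExact d D) {i : ℕ} (hi : i ≤ d)
    {a : D.X i ⟶ B.X i} {a' : D.X (i + 1) ⟶ B.X (i + 1)}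
    (sq : a' ≫ B.d (i + 1) i = D.d (i + 1) i ≫ a) (ha : NullAt D B (i + 1) a') :
    NullAt D B i a := by
  obtain ⟨h, h', rfl⟩ := ha
  change D.X i ⟶ B.X (i + 1) at h
  have key : D.d (i + 1) i ≫ (a - h ≫ B.d (i + 1) i) = 0 := by
    rw [Preadditive.comp_sub, ← sq]
    simp [Preadditive.add_comp]
  cases i with
  | zero =>
    rw [nullAt_zero_iff]
    exact ⟨h, (sub_eq_zero.1 (hD.exact_zero _ _ key)).symm⟩
  | succ i =>
    obtain ⟨y, hy⟩ := hD.exact i hi _ _ key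
    exact ⟨y, h, by simp [hy]⟩

/-- If all morphisms `D₀ ⟶ B₀` factor through `∂₁`, then all commutative squares from a
differential of `D` to the corresponding differential of `B` are null. The square is extended to
lower degrees by right exactness of `D`, and nullity in degree `0` is moved back up. -/
lemma nullAt_of_forall_factors {D B : ChainComplex C ℕ} (hD : IsRightDExact d D)
    (hB : IsLeftDExact d B)
    (hDB : ∀ a : D.X 0 ⟶ B.X 0, ∃ h : D.X 0 ⟶ B.X 1, h ≫ B.d 1 0 = a) {i : ℕ} (hi : i ≤ d)
    {a : D.X i ⟶ B.X i} {a' : D.X (i + 1) ⟶ B.X (i + 1)}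
    (sq : a' ≫ B.d (i + 1) i = D.d (i + 1) i ≫ a) : NullAt D B i a := by
  induction i with
  | zero => exact (nullAt_zero_iff a).2 (hDB a)
  | succ i ih =>
    obtain ⟨b, hb⟩ := hD.exact i hi _ (a ≫ B.d (i + 1) i) (by
      rw [← Category.assoc, ← sq, Category.assoc, B.d_comp_d, comp_zero])
    exact (ih (by omega) hb.symm).succ hB (by omega) hb.symm

lemma exists_factor_top_of_forall_factors {D B : ChainComplex C ℕ} (hD : IsRightDExact d D)
    (hB : IsLeftDExact d B)
    (hDB : ∀ a : D.X 0 ⟶ B.X 0, ∃ h : D.X 0 ⟶ B.X 1, h ≫ B.d 1 0 = a)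
    {a : D.X d ⟶ B.X d} {a' : D.X (d + 1) ⟶ B.X (d + 1)}
    (sq : a' ≫ B.d (d + 1) d = D.d (d + 1) d ≫ a) :
    ∃ h : D.X d ⟶ B.X (d + 1), D.d (d + 1) d ≫ h = a' :=
  (nullAt_top_iff hB.concentrated a').1
    ((nullAt_of_forall_factors hD hB hDB le_rfl sq).succ hB le_rfl sq)

/-- Nullity in any one degree of a morphism from a right `d`-exact sequence implies nullity in
degree `0`. -/
lemma NullAt.exists_lift {D B : ChainComplex C ℕ} (hD : IsRightDExact d D) (δ : D ⟶ B) {i : ℕ}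
    (hi : i ≤ d + 1) (h : NullAt D B i (δ.f i)) :
    ∃ h : D.X 0 ⟶ B.X 1, h ≫ B.d 1 0 = δ.f 0 := by
  induction i with
  | zero => exact (nullAt_zero_iff _).1 h
  | succ i ih => exact ih (by omega) (h.pred hD (by omega) (δ.comm _ _))

/-! ### Membership in the relative structure -/

lemma relative.exists_factor {E : ObjectProperty (ChainComplex C ℕ)} {𝒳 : ObjectProperty C}
    {B : ChainComplex C ℕ} (hB : relative E 𝒳 B) {X Y : C} (hX : 𝒳 X) (e : Y ≅ X)
    (a : Y ⟶ B.X 0) : ∃ h : Y ⟶ B.X 1, h ≫ B.d 1 0 = a := by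
  obtain ⟨y, hy⟩ := hB.2 X hX (e.inv ≫ a)
  exact ⟨e.hom ≫ y, by simp_all⟩

/-- A morphism `x : X ⟶ B₀` lifts along `∂₁` if the pullbacks of `B` along `x` map to `B` by a
morphism that is null in some degree. -/
lemma exists_lift_of_nullAt {E : ObjectProperty (ChainComplex C ℕ)} (hE : IsDExactStructure d E)
    {B : ChainComplex C ℕ} (hB : E B) {X : C} (x : X ⟶ B.X 0) {i : ℕ} (hi : i ≤ d + 1)
    (H : ∀ (D : ChainComplex C ℕ) (_ : E D) (_ : D.X 0 ≅ X) (δ : D ⟶ B),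
      NullAt D B i (δ.f i)) : ∃ y : X ⟶ B.X 1, y ≫ B.d 1 0 = x := by
  obtain ⟨D, δ, e, hD, h0, -, -⟩ := hE.pullback B hB X x
  obtain ⟨y, hy⟩ := (H D hD e δ).exists_lift (hE.isDExactSequence D hD).right δ hi
  exact ⟨e.inv ≫ y, by rw [Category.assoc, hy, h0, e.inv_hom_id_assoc]⟩

/-- An isomorphism of arrows as a pair of isomorphisms, with the two commutative squares that
express its compatibility and that of its inverse. -/
lemma exists_isos_of_arrow_iso {A : Type u} [Category.{v} A] {X Y X' Y' : A} {f : X ⟶ Y}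
    {g : X' ⟶ Y'} (α : Arrow.mk f ≅ Arrow.mk g) :
    ∃ (p : X ≅ X') (q : Y ≅ Y'), p.hom ≫ g = f ≫ q.hom ∧ p.inv ≫ f = g ≫ q.inv :=
  ⟨Arrow.leftFunc.mapIso α, Arrow.rightFunc.mapIso α, Arrow.w_mk_right α.hom,
    Arrow.w_mk_right α.inv⟩

/-- Membership in the relative structure depends on a single differential, in any degree. -/
lemma relative_of_arrow_iso {E : ObjectProperty (ChainComplex C ℕ)} (hE : IsDExactStructure d E)
    {𝒳 : ObjectProperty C} {B B' : ChainComplex C ℕ} (hB : relative E 𝒳 B) (hB' : E B') {k : ℕ}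
    (hk : k ≤ d) (α : Arrow.mk (B.d (k + 1) k) ≅ Arrow.mk (B'.d (k + 1) k)) :
    relative E 𝒳 B' := by
  refine ⟨hB', fun X hX x ↦ exists_lift_of_nullAt hE hB' x (i := k) (by omega) ?_⟩
  intro D hD e δ
  obtain ⟨p, q, w, w'⟩ := exists_isos_of_arrow_iso α
  obtain ⟨h, h', hh⟩ := nullAt_of_forall_factors (hE.isDExactSequence D hD).right
    (hE.isDExactSequence B hB.1).left (hB.exists_factor hX e) hk
    (a := δ.f k ≫ q.inv) (a' := δ.f (k + 1) ≫ p.inv) (by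
      rw [Category.assoc, w', δ.comm_assoc])
  refine ⟨h ≫ q.hom, h' ≫ p.hom, ?_⟩
  rw [Category.assoc, w, ← Category.assoc, ← Category.assoc, ← Preadditive.add_comp, ← hh,
    Category.assoc, q.inv_hom_id, Category.comp_id]

lemma relative_iff_of_isWeakIso {E : ObjectProperty (ChainComplex C ℕ)}
    (hE : IsDExactStructure d E) (𝒳 : ObjectProperty C) {B B' : ChainComplex C ℕ} (φ : B ⟶ B')
    (hB : E B) (hB' : E B') (hφ : IsWeakIso d φ) : relative E 𝒳 B ↔ relative E 𝒳 B' := by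
  rcases hφ with ⟨k, hk, h0, h1⟩ | ⟨h1, h0⟩
  · have α : Arrow.mk (B.d (k + 1) k) ≅ Arrow.mk (B'.d (k + 1) k) :=
      Arrow.isoMk (asIso (φ.f (k + 1))) (asIso (φ.f k)) (φ.comm _ _)
    exact ⟨fun h ↦ relative_of_arrow_iso hE h hB' hk α,
      fun h ↦ relative_of_arrow_iso hE h hB hk α.symm⟩
  · refine ⟨fun h ↦ ⟨hB', fun X hX x ↦ ?_⟩, fun h ↦ ⟨hB, fun X hX x ↦ ?_⟩⟩
    · obtain ⟨y, hy⟩ := h.2 X hX (x ≫ inv (φ.f 0))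
      refine ⟨y ≫ φ.f 1, ?_⟩
      dsimp at hy ⊢
      rw [Category.assoc, φ.comm, reassoc_of% hy, IsIso.inv_hom_id, Category.comp_id]
    · refine exists_lift_of_nullAt hE hB x le_rfl fun D hD e δ ↦ ?_
      rw [nullAt_top_iff (hE.isDExactSequence B hB).left.concentrated]
      obtain ⟨y, hy⟩ := exists_factor_top_of_forall_factors (hE.isDExactSequence D hD).right
        (hE.isDExactSequence B' hB').left (h.exists_factor hX e) ((δ ≫ φ).comm (d + 1) d)
      refine ⟨y ≫ inv (φ.f (d + 1)), ?_⟩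
      rw [reassoc_of% hy, HomologicalComplex.comp_f, Category.assoc, IsIso.hom_inv_id,
        Category.comp_id]

/-! ### Composition of inflations and deflations -/

lemma isInflation_relative_comp {E : ObjectProperty (ChainComplex C ℕ)}
    (hE : IsDExactStructure d E) (𝒳 : ObjectProperty C) {X Y Z : C} {f : X ⟶ Y} {g : Y ⟶ Z}
    (hf : IsInflation d (relative E 𝒳) f) (hg : IsInflation d (relative E 𝒳) g) :
    IsInflation d (relative E 𝒳) (f ≫ g) := by
  obtain ⟨B, hB, ⟨α⟩⟩ := hf
  obtain ⟨B', hB', ⟨β⟩⟩ := hg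
  obtain ⟨B'', hB'', ⟨γ⟩⟩ := hE.inflation_comp X Y Z f g ⟨B, hB.1, ⟨α⟩⟩ ⟨B', hB'.1, ⟨β⟩⟩
  refine ⟨B'', ⟨hB'', fun T hT x ↦ exists_lift_of_nullAt hE hB'' x le_rfl ?_⟩, ⟨γ⟩⟩
  intro D hD e δ
  rw [nullAt_top_iff (hE.isDExactSequence B'' hB'').left.concentrated]
  have hDr := (hE.isDExactSequence D hD).right
  obtain ⟨p, q, -, w⟩ := exists_isos_of_arrow_iso α
  obtain ⟨p', q', -, w'⟩ := exists_isos_of_arrow_iso β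
  obtain ⟨p'', q'', w'', -⟩ := exists_isos_of_arrow_iso γ
  obtain ⟨h, hh⟩ := exists_factor_top_of_forall_factors hDr
    (hE.isDExactSequence B' hB'.1).left (hB'.exists_factor hT e)
    (a := δ.f d ≫ q''.hom ≫ q'.inv) (a' := δ.f (d + 1) ≫ p''.hom ≫ f ≫ p'.inv) (by
      simp only [Category.assoc, w']
      rw [← δ.comm_assoc, ← reassoc_of% w''])
  obtain ⟨h₂, hh₂⟩ := exists_factor_top_of_forall_factors hDr
    (hE.isDExactSequence B hB.1).left (hB.exists_factor hT e)
    (a := h ≫ p'.hom ≫ q.inv) (a' := δ.f (d + 1) ≫ p''.hom ≫ p.inv) (by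
      simp only [Category.assoc, w]
      rw [reassoc_of% hh, p'.inv_hom_id_assoc])
  refine ⟨h₂ ≫ p.hom ≫ p''.inv, ?_⟩
  rw [reassoc_of% hh₂, p.inv_hom_id_assoc, p''.hom_inv_id, Category.comp_id]

lemma surjective_comp_of_arrow_iso {A : Type u} [Category.{v} A] {X Y X' Y' : A} {f : X ⟶ Y} {g : X' ⟶ Y'}
    (α : Arrow.mk f ≅ Arrow.mk g) {T : A}
    (hf : Function.Surjective fun h : T ⟶ X ↦ h ≫ f) :
    Function.Surjective fun h : T ⟶ X' ↦ h ≫ g := by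
  intro x
  obtain ⟨p, q, w, -⟩ := exists_isos_of_arrow_iso α
  obtain ⟨y, hy⟩ := hf (x ≫ q.inv)
  dsimp at hy
  refine ⟨y ≫ p.hom, ?_⟩
  dsimp
  rw [Category.assoc, w, reassoc_of% hy, q.inv_hom_id, Category.comp_id]

lemma isDeflation_relative_comp {E : ObjectProperty (ChainComplex C ℕ)}
    (hE : IsDExactStructure d E) (𝒳 : ObjectProperty C) {X Y Z : C} {f : X ⟶ Y} {g : Y ⟶ Z}
    (hf : IsDeflation (relative E 𝒳) f) (hg : IsDeflation (relative E 𝒳) g) :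
    IsDeflation (relative E 𝒳) (f ≫ g) := by
  obtain ⟨B, hB, ⟨α⟩⟩ := hf
  obtain ⟨B', hB', ⟨β⟩⟩ := hg
  obtain ⟨B'', hB'', ⟨γ⟩⟩ := hE.deflation_comp X Y Z f g ⟨B, hB.1, ⟨α⟩⟩ ⟨B', hB'.1, ⟨β⟩⟩
  refine ⟨B'', ⟨hB'', fun T hT ↦ surjective_comp_of_arrow_iso γ.symm fun x ↦ ?_⟩, ⟨γ⟩⟩
  obtain ⟨y, rfl⟩ := surjective_comp_of_arrow_iso β (hB'.2 T hT) x
  obtain ⟨z, rfl⟩ := surjective_comp_of_arrow_iso α (hB.2 T hT) y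
  exact ⟨z, (Category.assoc _ _ _).symm⟩

end DExact

open DExact in
theorem proposition3p6 {C : Type u} [Category.{v} C] [Preadditive C] [HasFiniteBiproducts C]
    (d : ℕ) (hd : 1 ≤ d) (E : ObjectProperty (ChainComplex C ℕ))
    (hE : DExact.IsSkeletallySmallDExactCategory.{w} d E)
    (𝒳 : ObjectProperty C) :
    DExact.IsSkeletallySmallDExactCategory.{w} d (DExact.relative E 𝒳) := by
  obtain ⟨hC, hE⟩ := hE
  refine ⟨hC, fun B hB ↦ hE.isDExactSequence B hB.1, fun B B' φ h h' hφ ↦ ?_,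
    fun B hB ↦ ⟨hE.zero B hB, fun X _ x ↦ ⟨0, (hB 0).eq_of_tgt _ _⟩⟩,
    fun _ _ _ _ _ ↦ isInflation_relative_comp hE 𝒳,
    fun _ _ _ _ _ ↦ isDeflation_relative_comp hE 𝒳, fun B hB A h ↦ ?_, fun B hB A g ↦ ?_⟩
  · have hEE := hE.weakIso B B' φ h h' hφ
    exact ⟨fun hB ↦ (relative_iff_of_isWeakIso hE 𝒳 φ hB.1 (hEE.1 hB.1) hφ).1 hB,
      fun hB' ↦ (relative_iff_of_isWeakIso hE 𝒳 φ (hEE.2 hB'.1) hB'.1 hφ).2 hB'⟩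
  · obtain ⟨D, φ, e, hD, hφ, h0, hpo⟩ := hE.pushout B hB.1 A h
    refine ⟨D, φ, e, ⟨hD, fun X hX x ↦ ?_⟩, hφ, h0, hpo⟩
    obtain ⟨y, hy⟩ := hB.2 X hX (x ≫ inv (φ.f 0))
    refine ⟨y ≫ φ.f 1, ?_⟩
    dsimp at hy ⊢
    rw [Category.assoc, φ.comm, reassoc_of% hy, IsIso.inv_hom_id, Category.comp_id]
  · obtain ⟨D, φ, e, hD, hφ, h1, hpb⟩ := hE.pullback B hB.1 A g
    refine ⟨D, φ, e, ⟨hD, fun X hX x ↦ ?_⟩, hφ, h1, hpb⟩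
    obtain ⟨y, hy⟩ := hB.2 X hX (x ≫ φ.f 0)
    -- Exactness of the cone at `D₀ ⊕ B₁`, which is part of the pullback condition as `0 < d`.
    obtain ⟨z, -, -, hz, -⟩ := hpb.exact 0 hd X x y
      (by rw [D.shape 0 (0 - 1) (by simp), comp_zero]) hy.symm
    exact ⟨z, hz⟩
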